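/- Let $\mathscr{C}$ be a triangulated category with shift $[1]$. All subcategories are full (and may be replaced by their closures under isomorphism). A pair $(\mathcal{T},\mathcal{F})$ of subcategories of a triangulated category $\mathscr{D}$ is a \emph{torsion pair} if $\mathrm{Hom}_{\mathscr{D}}(\mathcal{T},\mathcal{F})=0$ and every object $X$ of $\mathscr{D}$ lies in an exact triangle $A\to X\to B\to A[1]$ with $A\in\mathcal{T}$ and $B\in\mathcal{F}$. The idempotent completion $\widetilde{\mathscr{C}}$ has as objects the pairs $(A,e)$ with $A\in\mathscr{C}$ and $e=e^2\in\mathrm{End}(A)$, and as morphisms $(A,e)\to(B,f)$ the morphisms $\alpha:A\to B$ of $\mathscr{C}$ with $\alpha e=f\alpha=\alpha$. It carries its standard triangulated structure: $(A,e)[n]=(A[n],e[n])$, and a triangle of $\widetilde{\mathscr{C}}$ is exact if and only if it is a direct summand of the image of an exact triangle of $\mathscr{C}$ under the functor $A\mapsto(A,\mathrm{id}_A)$. For a subcategory $\mathcal{S}$ of $\mathscr{C}$ put $$\widetilde{\mathcal{S}}=\{(S,s)\mid S\in\mathcal{S},\ s\in\mathrm{End}(S)\text{ an idempotent}\}\subseteq\widetilde{\mathscr{C}}.$$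 Let $(\mathcal{T},\mathcal{F})$ be a torsion pair in $\mathscr{C}$ such that $\mathcal{F}[-1]\subseteq\mathcal{F}$ or $\mathcal{T}[1]\subseteq\mathcal{T}$ (up to isomorphism). Then $(\widetilde{\mathcal{T}},\widetilde{\mathcal{F}})$ is a torsion pair in $\widetilde{\mathscr{C}}$. Moreover, the closures of $\widetilde{\mathcal{T}}$ and of $\widetilde{\mathcal{F}}$ under isomorphism are closed under finite direct sums and direct summands. -/

import Mathlib

open CategoryTheory CategoryTheory.Limits CategoryTheory.Idempotents
  CategoryTheory.Pretriangulated

universe v u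

namespace KaroubiTriangulated

section Shift

variable (C : Type u) [Category.{v} C] [HasShift C ℤ]

instance whiskeringLeft_toKaroubi_full :
    ((Functor.whiskeringLeft C (Karoubi C) (Karoubi C)).obj (toKaroubi C)).Full :=
  (whiskeringLeftObjToKaroubiFullyFaithful (C := C) (D := Karoubi C)).full

instance whiskeringLeft_toKaroubi_faithful :
    ((Functor.whiskeringLeft C (Karoubi C) (Karoubi C)).obj (toKaroubi C)).Faithful :=
  (whiskeringLeftObjToKaroubiFullyFaithful (C := C) (D := Karoubi C)).faithful

/-- The shift on the idempotent completion: `(A, e)⟦n⟧ = (A⟦n⟧, e⟦n⟧)`. -/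
noncomputable instance karoubiHasShift : HasShift (Karoubi C) ℤ :=
  HasShift.induced (toKaroubi C) ℤ
    (fun n => (functorExtension₂ C C).obj (shiftFunctor C n))
    (fun n => (functorExtension₂CompWhiskeringLeftToKaroubiIso C C).app (shiftFunctor C n))

/-- The canonical functor `A ↦ (A, 𝟙 A)` commutes with the shifts. -/
noncomputable instance toKaroubiCommShift : (toKaroubi C).CommShift ℤ :=
  Functor.CommShift.ofInduced (toKaroubi C) ℤ
    (fun n => (functorExtension₂ C C).obj (shiftFunctor C n))
    (fun n => (functorExtension₂CompWhiskeringLeftToKaroubiIso C C).app (shiftFunctor C n))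

variable {C}

theorem shift_X (P : Karoubi C) (n : ℤ) : (P⟦n⟧).X = P.X⟦n⟧ := rfl

theorem shift_p (P : Karoubi C) (n : ℤ) : (P⟦n⟧).p = P.p⟦n⟧' := rfl

theorem shift_map_f {P Q : Karoubi C} (φ : P ⟶ Q) (n : ℤ) : (φ⟦n⟧').f = φ.f⟦n⟧' := rfl

theorem commShiftIso_hom_app_f (X : C) (n : ℤ) :
    (((toKaroubi C).commShiftIso n).hom.app X).f = 𝟙 (X⟦n⟧) := rfl

instance karoubi_shift_additive [Preadditive C]
    [∀ n : ℤ, (shiftFunctor C n).Additive] (n : ℤ) :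
    (shiftFunctor (Karoubi C) n).Additive where
  map_add {P Q f g} := by
    ext
    exact (shiftFunctor C n).map_add

end Shift

instance karoubi_hasZeroObject (C : Type u) [Category.{v} C] [Preadditive C]
    [HasZeroObject C] : HasZeroObject (Karoubi C) :=
  ⟨_, (toKaroubi C).map_isZero (isZero_zero C)⟩

section Triangles

variable (C : Type u) [Category.{v} C] [HasZeroObject C] [HasShift C ℤ] [Preadditive C]
  [∀ n : ℤ, (shiftFunctor C n).Additive] [Pretriangulated C]

/-- The exact triangles of the idempotent completion: the direct summands of (images of)
exact triangles of `C`. -/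
def karoubiDistTriang : Set (Triangle (Karoubi C)) :=
  {T | ∃ D ∈ distTriang C, Nonempty (Retract T ((toKaroubi C).mapTriangle.obj D))}

variable {C}

theorem karoubi_contractible (P : Karoubi C) :
    contractibleTriangle P ∈ karoubiDistTriang C := by
  refine ⟨_, contractible_distinguished P.X, ⟨?_⟩⟩
  have e : contractibleTriangle ((toKaroubi C).obj P.X) ≅
      (toKaroubi C).mapTriangle.obj (contractibleTriangle P.X) := by
    have hz : IsZero ((toKaroubi C).mapTriangle.obj (contractibleTriangle P.X)).obj₃ :=
      (toKaroubi C).map_isZero (isZero_zero C)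
    refine Triangle.isoMk _ _ (Iso.refl _) (Iso.refl _) ((isZero_zero _).iso hz) ?_ ?_ ?_
    · exact (Category.comp_id _).trans
        (((toKaroubi C).map_id P.X).symm.trans (Category.id_comp _).symm)
    · exact hz.eq_of_tgt _ _
    · exact (isZero_zero (Karoubi C)).eq_of_src _ _
  exact (P.retract.map (contractibleTriangleFunctor (Karoubi C))).trans (Retract.ofIso e)

/-- An endomorphism of an exact triangle whose first two components are idempotent can be
chosen with idempotent third component. -/
theorem exists_idempotent_third (D : Triangle C) (hD : D ∈ distTriang C)
    (a : D.obj₁ ⟶ D.obj₁) (b : D.obj₂ ⟶ D.obj₂) (ha : a ≫ a = a) (hb : b ≫ b = b)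
    (hab : D.mor₁ ≫ b = a ≫ D.mor₁) :
    ∃ p : D.obj₃ ⟶ D.obj₃, p ≫ p = p ∧ D.mor₂ ≫ p = b ≫ D.mor₂ ∧
      D.mor₃ ≫ a⟦(1 : ℤ)⟧' = p ≫ D.mor₃ := by
  obtain ⟨c, h₂, h₃⟩ := complete_distinguished_triangle_morphism D D hD hD a b hab
  have ha' : a⟦(1 : ℤ)⟧' ≫ a⟦(1 : ℤ)⟧' = a⟦(1 : ℤ)⟧' := by rw [← Functor.map_comp, ha]
  have h₂₂ : D.mor₂ ≫ c ≫ c = b ≫ D.mor₂ := by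
    rw [reassoc_of% h₂, h₂, reassoc_of% hb]
  have h₃₃ : (c ≫ c) ≫ D.mor₃ = D.mor₃ ≫ a⟦(1 : ℤ)⟧' := by
    rw [Category.assoc, ← h₃, ← reassoc_of% h₃, ha']
  obtain ⟨s, hs⟩ := Triangle.yoneda_exact₃ D hD (c ≫ c - c) (by
    rw [Preadditive.comp_sub, h₂₂, h₂, sub_self])
  have hsq : (c ≫ c - c) ≫ (c ≫ c - c) = 0 := by
    have hz : (c ≫ c - c) ≫ D.mor₃ = 0 := by
      rw [Preadditive.sub_comp, h₃₃, h₃, sub_self]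
    calc (c ≫ c - c) ≫ (c ≫ c - c) = (c ≫ c - c) ≫ D.mor₃ ≫ s := by rw [← hs]
      _ = 0 := by rw [reassoc_of% hz, zero_comp]
  let c' : End D.obj₃ := c
  let p : End D.obj₃ := 3 • (c' * c') - 2 • (c' * c' * c')
  have hp : p * p = p := by
    have h : p * p - p = ((c' * c' - c') * (c' * c' - c')) *
        (4 • (c' * c') - 4 • c' - 3 • 1) := by
      dsimp only [p]
      noncomm_ring
    have hsq' : (c' * c' - c') * (c' * c' - c') = 0 := hsq
    rw [hsq', zero_mul] at h
    exact sub_eq_zero.mp h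
  have hp' : (p : D.obj₃ ⟶ D.obj₃) = 3 • (c ≫ c) - 2 • (c ≫ c ≫ c) := rfl
  refine ⟨p, hp, ?_, ?_⟩
  · have h : D.mor₂ ≫ c ≫ c ≫ c = b ≫ D.mor₂ := by
      rw [reassoc_of% h₂, h₂₂, reassoc_of% hb]
    rw [hp', Preadditive.comp_sub, Preadditive.comp_nsmul, Preadditive.comp_nsmul, h, h₂₂]
    module
  · have h : (c ≫ c ≫ c) ≫ D.mor₃ = D.mor₃ ≫ a⟦(1 : ℤ)⟧' := by
      rw [Category.assoc, h₃₃, ← reassoc_of% h₃, ha']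
    rw [hp', Preadditive.sub_comp, Preadditive.nsmul_comp, Preadditive.nsmul_comp, h, h₃₃]
    module

theorem karoubi_cocone_triangle {P Q : Karoubi C} (φ : P ⟶ Q) :
    ∃ (R : Karoubi C) (g : Q ⟶ R) (h : R ⟶ P⟦(1 : ℤ)⟧),
      Triangle.mk φ g h ∈ karoubiDistTriang C := by
  obtain ⟨Z, g, h, hD⟩ := distinguished_cocone_triangle φ.f
  obtain ⟨r, hr, h₂, h₃⟩ := exists_idempotent_third _ hD P.p Q.p P.idem Q.idem
    (Karoubi.p_comm φ).symm
  change Z ⟶ Z at r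
  change g ≫ r = Q.p ≫ g at h₂
  change h ≫ P.p⟦(1 : ℤ)⟧' = r ≫ h at h₃
  let R : Karoubi C := ⟨Z, r, hr⟩
  let g' : Q ⟶ R := ⟨Q.p ≫ g, by
    change Q.p ≫ (Q.p ≫ g) ≫ r = _
    rw [Category.assoc, h₂, Q.idem_assoc, Q.idem_assoc]⟩
  have hP : P.p⟦(1 : ℤ)⟧' ≫ P.p⟦(1 : ℤ)⟧' = P.p⟦(1 : ℤ)⟧' := by
    rw [← Functor.map_comp, P.idem]
  have hr₃ : r ≫ h ≫ P.p⟦(1 : ℤ)⟧' = h ≫ P.p⟦(1 : ℤ)⟧' := by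
    rw [← reassoc_of% h₃, hP]
  have hP₃ : (h ≫ P.p⟦(1 : ℤ)⟧') ≫ P.p⟦(1 : ℤ)⟧' = h ≫ P.p⟦(1 : ℤ)⟧' := by
    rw [Category.assoc, hP]
  let h' : R ⟶ P⟦(1 : ℤ)⟧ := ⟨h ≫ P.p⟦(1 : ℤ)⟧', (congr_arg (fun k => r ≫ k) hP₃).trans hr₃⟩
  have q₁ : φ.f ≫ Q.p = P.p ≫ φ.f := by simp
  have q₂ : (Q.p ≫ g) ≫ r = Q.p ≫ g := by rw [Category.assoc, h₂, Q.idem_assoc]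
  have q₂' : g ≫ r = Q.p ≫ Q.p ≫ g := by rw [Q.idem_assoc, h₂]
  have q₃ : (h ≫ P.p⟦(1 : ℤ)⟧') ≫ P.p⟦(1 : ℤ)⟧' = r ≫ h ≫ 𝟙 _ := by
    rw [hP₃, Category.comp_id, h₃]
  have q₃' : (h ≫ 𝟙 _) ≫ P.p⟦(1 : ℤ)⟧' = r ≫ h ≫ P.p⟦(1 : ℤ)⟧' := by
    rw [Category.comp_id, hr₃]
  refine ⟨R, g', h', _, hD, ⟨⟨?_, ?_, ?_⟩⟩⟩
  · exact Triangle.homMk _ _ P.retract.i Q.retract.i R.retract.i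
      (Karoubi.hom_ext _ _ q₁) (Karoubi.hom_ext _ _ q₂) (Karoubi.hom_ext _ _ q₃)
  · exact Triangle.homMk _ _ P.retract.r Q.retract.r R.retract.r
      (Karoubi.hom_ext _ _ q₁) (Karoubi.hom_ext _ _ q₂') (Karoubi.hom_ext _ _ q₃')
  · ext1
    · exact P.retract.retract
    · exact Q.retract.retract
    · exact R.retract.retract

theorem karoubi_rotate_iff (T : Triangle (Karoubi C)) :
    T ∈ karoubiDistTriang C ↔ T.rotate ∈ karoubiDistTriang C := by
  constructor
  · rintro ⟨D, hD, ⟨ρ⟩⟩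
    exact ⟨D.rotate, rot_of_distTriang _ hD,
      ⟨(ρ.map (Pretriangulated.rotate (Karoubi C))).trans
        (Retract.ofIso ((toKaroubi C).mapTriangleRotateIso.app D))⟩⟩
  · rintro ⟨D, hD, ⟨ρ⟩⟩
    exact ⟨D.invRotate, inv_rot_of_distTriang _ hD,
      ⟨(Retract.ofIso ((rotCompInvRot (C := Karoubi C)).app T)).trans
        ((ρ.map (Pretriangulated.invRotate (Karoubi C))).trans
          (Retract.ofIso ((toKaroubi C).mapTriangleInvRotateIso.app D)))⟩⟩

theorem complete_image_morphism (D₁ D₂ : Triangle C) (h₁ : D₁ ∈ distTriang C)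
    (h₂ : D₂ ∈ distTriang C)
    (a : ((toKaroubi C).mapTriangle.obj D₁).obj₁ ⟶ ((toKaroubi C).mapTriangle.obj D₂).obj₁)
    (b : ((toKaroubi C).mapTriangle.obj D₁).obj₂ ⟶ ((toKaroubi C).mapTriangle.obj D₂).obj₂)
    (hab : ((toKaroubi C).mapTriangle.obj D₁).mor₁ ≫ b =
      a ≫ ((toKaroubi C).mapTriangle.obj D₂).mor₁) :
    ∃ χ : (toKaroubi C).mapTriangle.obj D₁ ⟶ (toKaroubi C).mapTriangle.obj D₂,
      χ.hom₁ = a ∧ χ.hom₂ = b := by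
  obtain ⟨a', rfl⟩ := (toKaroubi C).map_surjective (X := D₁.obj₁) (Y := D₂.obj₁) a
  obtain ⟨b', rfl⟩ := (toKaroubi C).map_surjective (X := D₁.obj₂) (Y := D₂.obj₂) b
  have hab' : D₁.mor₁ ≫ b' = a' ≫ D₂.mor₁ := congr_arg Karoubi.Hom.f hab
  obtain ⟨c', h₂, h₃⟩ := complete_distinguished_triangle_morphism _ _ h₁ h₂ a' b' hab'
  exact ⟨(toKaroubi C).mapTriangle.map (Triangle.homMk _ _ a' b' c' hab' h₂ h₃), rfl, rfl⟩

theorem karoubi_complete_morphism (T₁ T₂ : Triangle (Karoubi C))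
    (hT₁ : T₁ ∈ karoubiDistTriang C) (hT₂ : T₂ ∈ karoubiDistTriang C)
    (a : T₁.obj₁ ⟶ T₂.obj₁) (b : T₁.obj₂ ⟶ T₂.obj₂) (hab : T₁.mor₁ ≫ b = a ≫ T₂.mor₁) :
    ∃ c : T₁.obj₃ ⟶ T₂.obj₃, T₁.mor₂ ≫ c = b ≫ T₂.mor₂ ∧
      T₁.mor₃ ≫ a⟦(1 : ℤ)⟧' = c ≫ T₂.mor₃ := by
  obtain ⟨D₁, hD₁, ⟨ρ₁⟩⟩ := hT₁
  obtain ⟨D₂, hD₂, ⟨ρ₂⟩⟩ := hT₂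
  have key := complete_image_morphism D₁ D₂ hD₁ hD₂
  generalize (toKaroubi C).mapTriangle.obj D₁ = E₁ at ρ₁ key
  generalize (toKaroubi C).mapTriangle.obj D₂ = E₂ at ρ₂ key
  obtain ⟨ψ, h₁, h₂⟩ := key (ρ₁.r.hom₁ ≫ a ≫ ρ₂.i.hom₁) (ρ₁.r.hom₂ ≫ b ≫ ρ₂.i.hom₂) (by
    rw [reassoc_of% ρ₁.r.comm₁, reassoc_of% hab, Category.assoc, Category.assoc, ρ₂.i.comm₁])
  let χ : T₁ ⟶ T₂ := ρ₁.i ≫ ψ ≫ ρ₂.r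
  have e₁ : ρ₁.i.hom₁ ≫ ρ₁.r.hom₁ = 𝟙 _ := congr_arg TriangleMorphism.hom₁ ρ₁.retract
  have e₂ : ρ₁.i.hom₂ ≫ ρ₁.r.hom₂ = 𝟙 _ := congr_arg TriangleMorphism.hom₂ ρ₁.retract
  have e₁' : ρ₂.i.hom₁ ≫ ρ₂.r.hom₁ = 𝟙 _ := congr_arg TriangleMorphism.hom₁ ρ₂.retract
  have e₂' : ρ₂.i.hom₂ ≫ ρ₂.r.hom₂ = 𝟙 _ := congr_arg TriangleMorphism.hom₂ ρ₂.retract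
  have hχ₁ : χ.hom₁ = a := by
    change ρ₁.i.hom₁ ≫ ψ.hom₁ ≫ ρ₂.r.hom₁ = a
    rw [h₁, Category.assoc, Category.assoc, e₁', Category.comp_id, reassoc_of% e₁]
  have hχ₂ : χ.hom₂ = b := by
    change ρ₁.i.hom₂ ≫ ψ.hom₂ ≫ ρ₂.r.hom₂ = b
    rw [h₂, Category.assoc, Category.assoc, e₂', Category.comp_id, reassoc_of% e₂]
  refine ⟨χ.hom₃, ?_, ?_⟩
  · rw [χ.comm₂, hχ₂]
  · rw [← hχ₁, χ.comm₃]

variable (C)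

/-- The triangulated structure on the idempotent completion. -/
instance karoubiPretriangulated : Pretriangulated (Karoubi C) where
  distinguishedTriangles := karoubiDistTriang C
  isomorphic_distinguished := by
    rintro T₁ ⟨D, hD, ⟨ρ⟩⟩ T₂ e
    exact ⟨D, hD, ⟨(Retract.ofIso e).trans ρ⟩⟩
  contractible_distinguished := karoubi_contractible
  distinguished_cocone_triangle := karoubi_cocone_triangle
  rotate_distinguished_triangle := karoubi_rotate_iff
  complete_distinguished_triangle_morphism := karoubi_complete_morphism

end Triangles

end KaroubiTriangulated

/-- A torsion pair `(T, F)` of full subcategories of a triangulated category `C`: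
`Hom(T, F) = 0` and every object `X` lies in an exact triangle `A ⟶ X ⟶ B ⟶ A⟦1⟧`
with `A` in `T` and `B` in `F`. -/
structure IsTorsionPair {C : Type u} [Category.{v} C] [HasZeroObject C] [HasShift C ℤ]
    [Preadditive C] [∀ n : ℤ, (shiftFunctor C n).Additive] [Pretriangulated C]
    (T F : ObjectProperty C) : Prop where
  hom_eq_zero : ∀ ⦃A B : C⦄, T A → F B → ∀ f : A ⟶ B, f = 0
  exists_triangle : ∀ X : C, ∃ (A B : C) (f : A ⟶ X) (g : X ⟶ B) (h : B ⟶ A⟦(1 : ℤ)⟧),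
    T A ∧ F B ∧ Triangle.mk f g h ∈ distTriang C

/-- The full subcategory of the idempotent completion consisting of all pairs `(A, e)` with `A`
in `S` and `e` an arbitrary idempotent endomorphism of `A`. -/
def karoubiSubcategory {C : Type u} [Category.{v} C] (S : ObjectProperty C) :
    ObjectProperty (Karoubi C) :=
  fun P => S P.X

/-! Given `(X, e)`, take a torsion triangle `A ⟶ X ⟶ B` of `X` in `C`. As `Hom(A, B) = 0`, the
idempotent `e` restricts along `A ⟶ X` to some `a`. The defect `a² - a` dies in `X`, so its shift
factors through a map `A⟦1⟧ ⟶ B`, and the shift hypothesis kills every such map; hence `a` is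
idempotent. A filler on `B` can be corrected to an idempotent by `exists_idempotent_third`, and the
image of the resulting idempotent of triangles is the required triangle of `Karoubi C`.

For the closure properties, each half of the new pair is, up to isomorphism, the orthogonal of the
other, and orthogonals are stable under finite sums and retracts. -/

namespace KaroubiTriangulated

section Retracts

variable {C : Type u} [Category.{v} C]

/-- Up to isomorphism, `karoubiSubcategory S` contains the direct summands of its objects. -/
theorem karoubiSubcategory_isoClosure_of_retract {S : ObjectProperty C} {P Q : Karoubi C}
    (ρ : Retract P Q) (hQ : karoubiSubcategory S Q) : (karoubiSubcategory S).isoClosure P := by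
  have hρ : ρ.i.f ≫ ρ.r.f = P.p := congr_arg Karoubi.Hom.f ρ.retract
  -- The summand is realised by an idempotent on the same underlying object `Q.X`, so no closure
  -- property of `S` is needed.
  let R : Karoubi C := ⟨Q.X, ρ.r.f ≫ ρ.i.f, by
    rw [Category.assoc, reassoc_of% hρ, Karoubi.p_comp]⟩
  refine ⟨R, hQ, ⟨⟨⟨ρ.i.f, ?_⟩, ⟨ρ.r.f, ?_⟩, ?_, ?_⟩⟩⟩
  · change P.p ≫ ρ.i.f ≫ ρ.r.f ≫ ρ.i.f = ρ.i.f
    rw [reassoc_of% hρ, Karoubi.p_comp, Karoubi.p_comp]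
  · change (ρ.r.f ≫ ρ.i.f) ≫ ρ.r.f ≫ P.p = ρ.r.f
    rw [Karoubi.comp_p, Category.assoc, hρ, Karoubi.comp_p]
  · exact Karoubi.hom_ext _ _ hρ
  · exact Karoubi.hom_ext _ _ rfl

end Retracts

section Orthogonal

variable {C : Type u} [Category.{v} C] [Preadditive C]

theorem leftOrthogonal_isClosedUnderFiniteCoproducts (S : ObjectProperty C) :
    S.leftOrthogonal.IsClosedUnderFiniteCoproducts where
  isClosedUnderColimitsOfShape J _ :=
    ⟨by
      rintro X ⟨p⟩ Y f hY
      exact p.isColimit.hom_ext fun j => by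
        rw [comp_zero]
        exact p.prop_diag_obj j _ hY⟩

theorem rightOrthogonal_isClosedUnderFiniteCoproducts (S : ObjectProperty C) :
    S.rightOrthogonal.IsClosedUnderFiniteCoproducts where
  isClosedUnderColimitsOfShape J _ :=
    ⟨by
      have := Fintype.ofFinite J
      rintro X ⟨p⟩ Y f hY
      -- A map into the coproduct is tested on projections, so the finite coproduct is first turned
      -- into a biproduct.
      let b := biconeIsBilimitOfColimitCoconeOfIsColimit
        ((IsColimit.precomposeInvEquiv Discrete.natIsoFunctor _).symm p.isColimit)
      exact b.isLimit.hom_ext fun j => by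
        refine Eq.trans ?_ zero_comp.symm
        exact p.prop_diag_obj j _ hY⟩

theorem leftOrthogonal_isStableUnderRetracts (S : ObjectProperty C) :
    S.leftOrthogonal.IsStableUnderRetracts where
  of_retract {X Y} ρ hY Z f hZ := by
    rw [← Category.id_comp f, ← ρ.retract, Category.assoc, hY (ρ.r ≫ f) hZ, comp_zero]

theorem rightOrthogonal_isStableUnderRetracts (S : ObjectProperty C) :
    S.rightOrthogonal.IsStableUnderRetracts where
  of_retract {X Y} ρ hY Z f hZ := by
    rw [← Category.comp_id f, ← ρ.retract, ← Category.assoc, hY (f ≫ ρ.i) hZ, zero_comp]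

end Orthogonal

section Torsion

variable {C : Type u} [Category.{v} C] [HasZeroObject C] [HasShift C ℤ] [Preadditive C]
  [∀ n : ℤ, (shiftFunctor C n).Additive] [Pretriangulated C]

/-- An idempotent endomorphism of an exact triangle splits in the idempotent completion, and
its image is an exact triangle. -/
theorem exists_karoubi_triangle_of_idempotents {X Y Z : C} (f : X ⟶ Y) (g : Y ⟶ Z)
    (h : Z ⟶ X⟦(1 : ℤ)⟧) (hD : Triangle.mk f g h ∈ distTriang C) (a : X ⟶ X) (b : Y ⟶ Y)
    (c : Z ⟶ Z) (ha : a ≫ a = a) (hb : b ≫ b = b) (hc : c ≫ c = c)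
    (h₁ : f ≫ b = a ≫ f) (h₂ : g ≫ c = b ≫ g) (h₃ : h ≫ a⟦(1 : ℤ)⟧' = c ≫ h) :
    ∃ (f' : (⟨X, a, ha⟩ : Karoubi C) ⟶ ⟨Y, b, hb⟩) (g' : (⟨Y, b, hb⟩ : Karoubi C) ⟶ ⟨Z, c, hc⟩)
      (h' : (⟨Z, c, hc⟩ : Karoubi C) ⟶ (⟨X, a, ha⟩ : Karoubi C)⟦(1 : ℤ)⟧),
      Triangle.mk f' g' h' ∈ distTriang (Karoubi C) := by
  let P : Karoubi C := ⟨X, a, ha⟩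
  let Q : Karoubi C := ⟨Y, b, hb⟩
  let R : Karoubi C := ⟨Z, c, hc⟩
  have e₁ : a ≫ a ≫ f = a ≫ f := by rw [reassoc_of% ha]
  have e₂ : b ≫ b ≫ g = b ≫ g := by rw [reassoc_of% hb]
  have e₃ : c ≫ c ≫ h = c ≫ h := by rw [reassoc_of% hc]
  let f' : P ⟶ Q := ⟨a ≫ f, by
    change a ≫ (a ≫ f) ≫ b = a ≫ f
    rw [Category.assoc, h₁, e₁, e₁]⟩
  let g' : Q ⟶ R := ⟨b ≫ g, by
    change b ≫ (b ≫ g) ≫ c = b ≫ g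
    rw [Category.assoc, h₂, e₂, e₂]⟩
  let h' : R ⟶ P⟦(1 : ℤ)⟧ := ⟨c ≫ h, by
    change c ≫ (c ≫ h) ≫ a⟦(1 : ℤ)⟧' = c ≫ h
    rw [Category.assoc, h₃, e₃, e₃]⟩
  have q₁ : (a ≫ f) ≫ b = a ≫ f := by rw [Category.assoc, h₁, e₁]
  have q₂ : (b ≫ g) ≫ c = b ≫ g := by rw [Category.assoc, h₂, e₂]
  -- The `𝟙 _` underlies the comparison of `toKaroubi` with the shift, which enters the third map of
  -- the image triangle.
  have q₃ : (c ≫ h) ≫ a⟦(1 : ℤ)⟧' = c ≫ h ≫ 𝟙 _ := by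
    rw [Category.comp_id, Category.assoc, h₃, e₃]
  have q₃' : (h ≫ 𝟙 _) ≫ a⟦(1 : ℤ)⟧' = c ≫ c ≫ h := by
    rw [Category.comp_id, h₃, e₃]
  refine ⟨f', g', h', _, hD, ⟨⟨?_, ?_, ?_⟩⟩⟩
  · exact Triangle.homMk _ _ P.retract.i Q.retract.i R.retract.i
      (Karoubi.hom_ext _ _ q₁) (Karoubi.hom_ext _ _ q₂) (Karoubi.hom_ext _ _ q₃)
  · exact Triangle.homMk _ _ P.retract.r Q.retract.r R.retract.r
      (Karoubi.hom_ext _ _ (h₁.trans e₁.symm)) (Karoubi.hom_ext _ _ (h₂.trans e₂.symm))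
      (Karoubi.hom_ext _ _ q₃')
  · ext1
    · exact P.retract.retract
    · exact Q.retract.retract
    · exact R.retract.retract

variable {T F : ObjectProperty C}

/-- Either alternative reduces to `Hom(T, F) = 0`: desuspend to a map `A ⟶ B⟦-1⟧`, or regard `A⟦1⟧`
as an object of `T`. -/
theorem _root_.IsTorsionPair.shift_hom_eq_zero (hTF : IsTorsionPair T F)
    (hshift : (∀ X, F X → F.isoClosure (X⟦(-1 : ℤ)⟧)) ∨
      (∀ X, T X → T.isoClosure (X⟦(1 : ℤ)⟧)))
    {A B : C} (hA : T A) (hB : F B) (f : A⟦(1 : ℤ)⟧ ⟶ B) : f = 0 := by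
  rcases hshift with h | h
  · obtain ⟨B', hB', ⟨e⟩⟩ := h B hB
    apply (shiftFunctor C (-1 : ℤ)).map_injective
    rw [Functor.map_zero, ← cancel_epi ((shiftShiftNeg A (1 : ℤ)).inv), ← cancel_mono e.hom,
      comp_zero, zero_comp]
    exact hTF.hom_eq_zero hA hB' _
  · obtain ⟨A', hA', ⟨e⟩⟩ := h A hA
    rw [← cancel_epi e.inv, comp_zero]
    exact hTF.hom_eq_zero hA' hB _

/-- If `P` has no maps to the torsion-free part, then `P ⟶ B` vanishes in its torsion triangle, so
`𝟙 P` factors through `A` and `P` is a retract of `A`. -/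
theorem _root_.IsTorsionPair.isoClosure_karoubiSubcategory_left
    (h : IsTorsionPair (karoubiSubcategory T) (karoubiSubcategory F)) :
    (karoubiSubcategory T).isoClosure = (karoubiSubcategory F).leftOrthogonal := by
  apply le_antisymm
  · rw [ObjectProperty.isoClosure_le_iff]
    exact fun P hP Q f hQ => h.hom_eq_zero hP hQ f
  · intro P hP
    obtain ⟨A, B, f, g, _, hA, hB, hD⟩ := h.exists_triangle P
    obtain ⟨s, hs⟩ := Triangle.coyoneda_exact₂ _ hD (𝟙 P) ((Category.id_comp _).trans (hP g hB))
    exact karoubiSubcategory_isoClosure_of_retract ⟨s, f, hs.symm⟩ hA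

theorem _root_.IsTorsionPair.isoClosure_karoubiSubcategory_right
    (h : IsTorsionPair (karoubiSubcategory T) (karoubiSubcategory F)) :
    (karoubiSubcategory F).isoClosure = (karoubiSubcategory T).rightOrthogonal := by
  apply le_antisymm
  · rw [ObjectProperty.isoClosure_le_iff]
    exact fun P hP Q f hQ => h.hom_eq_zero hQ hP f
  · intro P hP
    obtain ⟨A, B, f, g, _, hA, hB, hD⟩ := h.exists_triangle P
    obtain ⟨s, hs⟩ := Triangle.yoneda_exact₂ _ hD (𝟙 P) ((Category.comp_id _).trans (hP f hA))
    exact karoubiSubcategory_isoClosure_of_retract ⟨g, s, hs.symm⟩ hB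

theorem _root_.IsTorsionPair.karoubi (hTF : IsTorsionPair T F)
    (hshift : ∀ ⦃A B : C⦄, T A → F B → ∀ f : A⟦(1 : ℤ)⟧ ⟶ B, f = 0) :
    IsTorsionPair (karoubiSubcategory T) (karoubiSubcategory F) where
  hom_eq_zero P Q hP hQ f := Karoubi.hom_ext _ _ (hTF.hom_eq_zero hP hQ f.f)
  exists_triangle P := by
    obtain ⟨X, e, he⟩ := P
    obtain ⟨A, B, f, g, h, hA, hB, hD⟩ := hTF.exists_triangle X
    obtain ⟨a, ha⟩ : ∃ a : A ⟶ A, f ≫ e = a ≫ f :=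
      Triangle.coyoneda_exact₂ _ hD (f ≫ e) (hTF.hom_eq_zero hA hB _)
    have ha' : a ≫ a = a := by
      apply (shiftFunctor C (1 : ℤ)).map_injective
      rw [← sub_eq_zero, ← Functor.map_sub]
      -- Both `a ≫ a ≫ f` and `a ≫ f` equal `f ≫ e`, so the shifted defect factors as `s ≫ h` with
      -- `s : A⟦1⟧ ⟶ B`.
      obtain ⟨s, hs⟩ := Triangle.coyoneda_exact₁ _ hD ((a ≫ a - a)⟦(1 : ℤ)⟧') (by
        change (a ≫ a - a)⟦(1 : ℤ)⟧' ≫ f⟦(1 : ℤ)⟧' = 0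
        rw [← Functor.map_comp, Preadditive.sub_comp, Category.assoc, ← ha, ← reassoc_of% ha, he,
          sub_self, Functor.map_zero])
      rw [hshift hA hB s] at hs
      exact hs.trans zero_comp
    obtain ⟨b, hb, h₂, h₃⟩ := exists_idempotent_third _ hD a e ha' he ha
    obtain ⟨f', g', h', hD'⟩ :=
      exists_karoubi_triangle_of_idempotents f g h hD a e b ha' he hb ha h₂ h₃
    exact ⟨_, _, f', g', h', hA, hB, hD'⟩

end Torsion

end KaroubiTriangulated

theorem mainTheorem7 {C : Type u} [Category.{v} C] [HasZeroObject C] [HasShift C ℤ]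
    [Preadditive C] [∀ n : ℤ, (shiftFunctor C n).Additive] [Pretriangulated C]
    [IsTriangulated C] (T F : ObjectProperty C) (hTF : IsTorsionPair T F)
    (hshift : (∀ X, F X → F.isoClosure (X⟦(-1 : ℤ)⟧)) ∨
      (∀ X, T X → T.isoClosure (X⟦(1 : ℤ)⟧))) :
    IsTorsionPair (karoubiSubcategory T) (karoubiSubcategory F) ∧
      ((karoubiSubcategory T).isoClosure.IsClosedUnderFiniteCoproducts ∧
        (karoubiSubcategory T).isoClosure.IsStableUnderRetracts) ∧
      ((karoubiSubcategory F).isoClosure.IsClosedUnderFiniteCoproducts ∧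
        (karoubiSubcategory F).isoClosure.IsStableUnderRetracts) := by
  have h := hTF.karoubi fun _ _ hA hB f => hTF.shift_hom_eq_zero hshift hA hB f
  rw [h.isoClosure_karoubiSubcategory_left, h.isoClosure_karoubiSubcategory_right]
  exact ⟨h, ⟨KaroubiTriangulated.leftOrthogonal_isClosedUnderFiniteCoproducts _,
    KaroubiTriangulated.leftOrthogonal_isStableUnderRetracts _⟩,
    KaroubiTriangulated.rightOrthogonal_isClosedUnderFiniteCoproducts _,
    KaroubiTriangulated.rightOrthogonal_isStableUnderRetracts _⟩
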